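/- Let $M$ be a smooth manifold (Hausdorff, second countable) of dimension $2n+1$, $n\ge 0$, with a smooth almost contact metric structure $(\phi,\xi,\eta,g)$: $g$ is a Riemannian metric, $\phi$ a $(1,1)$-tensor field, $\xi$ a vector field and $\eta$ a $1$-form with $$\phi^2=-I+\eta\otimes\xi,\qquad \eta(\xi)=1,\qquad g(\phi X,\phi Y)=g(X,Y)-\eta(X)\eta(Y).$$ Put $\Phi(X,Y)=g(X,\phi Y)$ and assume that $M$ is almost Kenmotsu, i.e. $d\eta=0$ and $d\Phi=2\,\eta\wedge\Phi$. Let $\nabla$ be the Levi-Civita connection of $g$. Let $V$ be a holomorphically planar conformal vector (HPCV) field on $M$, that is, a smooth vector field for which there are smooth functions $a,b$ on $M$ with $$\nabla_XV=aX+b\,\phi X\qquad\text{for every vector field } X.$$ Assume that $\phi V=0$ and that $V$ is non-zero in the sense that it does not vanish identically on any connected component of $M$ (for connected $M$: $V\not\equiv 0$). Then every integral manifold of the distribution $\mathcal D=\ker\eta$, i.e. every injectively immersed smooth submanifold $N\subset M$ of dimension $2n$ with $T_pN=\mathcal D_p$ for all $p\in N$, is a totally umbilical submanifold of $M$: there is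 a smooth normal vector field $H$ along $N$ such that the second fundamental form $\mathrm{II}(X,Y)=(\nabla_XY)^{\perp}$ of $N$ satisfies $\mathrm{II}(X,Y)=g(X,Y)\,H$ for all $X,Y$ tangent to $N$. -/

import Mathlib

open Bundle VectorField
open scoped Manifold ContDiff Topology

section LeviCivita
variable {E : Type*} [NormedAddCommGroup E] [NormedSpace ℝ E] [FiniteDimensional ℝ E]
  {H : Type*} [TopologicalSpace H] {I : ModelWithCorners ℝ E H}
  {M : Type*} [TopologicalSpace M] [ChartedSpace H M] [IsManifold I 2 M]
  [RiemannianBundle (fun x : M ↦ TangentSpace I x)]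

/-- The right-hand side of the Koszul formula: for the Levi-Civita connection `∇` it equals
`2 ⟨∇_X Y, Z⟩`. Here `d% f x (X x)` is the derivative of `f` along `X` at `x`. -/
noncomputable def koszul (I : ModelWithCorners ℝ E H) {M : Type*} [TopologicalSpace M]
    [ChartedSpace H M] [IsManifold I 2 M] [RiemannianBundle (fun x : M ↦ TangentSpace I x)]
    (X Y Z : Π x : M, TangentSpace I x) (x : M) : ℝ :=
  d% (fun y ↦ inner ℝ (Y y) (Z y)) x (X x) + d% (fun y ↦ inner ℝ (X y) (Z y)) x (Y x)
    - d% (fun y ↦ inner ℝ (X y) (Y y)) x (Z x)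
    + inner ℝ (mlieBracket I X Y x) (Z x) - inner ℝ (mlieBracket I X Z x) (Y x)
    - inner ℝ (mlieBracket I Y Z x) (X x)

variable [IsContMDiffRiemannianBundle I 1 E (fun x : M ↦ TangentSpace I x)]

set_option linter.unusedSectionVars false in
theorem mdiffAt_inner {X Y : Π x : M, TangentSpace I x} {x : M}
    (hX : MDiffAt (T% X) x) (hY : MDiffAt (T% Y) x) :
    MDiffAt (fun y ↦ inner ℝ (X y) (Y y)) x :=
  MDifferentiableAt.inner_bundle (F := E) (E := fun x : M ↦ TangentSpace I x) hX hY

theorem koszul_tensorial₁ (Y Z : Π x : M, TangentSpace I x) (x : M)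
    (hY : MDiffAt (T% Y) x) (hZ : MDiffAt (T% Z) x) :
    TensorialAt I E (fun X ↦ koszul I X Y Z x) x where
  smul {f X} hf hX := by
    have e1 : d% (fun y ↦ inner ℝ ((f • X) y) (Z y)) x
        = d% (fun y ↦ f y * inner ℝ (X y) (Z y)) x := by
      congr 1; ext y; simp [inner_smul_left]
    have e2 : d% (fun y ↦ inner ℝ ((f • X) y) (Y y)) x
        = d% (fun y ↦ f y * inner ℝ (X y) (Y y)) x := by
      congr 1; ext y; simp [inner_smul_left]
    simp only [koszul]
    rw [e1, e2, mvfderiv_fun_mul hf (mdiffAt_inner hX hZ), mvfderiv_fun_mul hf (mdiffAt_inner hX hY),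
      mlieBracket_smul_left hf hX, mlieBracket_smul_left hf hX]
    simp [inner_add_left, inner_smul_left, inner_smul_right]
    ring
  add {X X'} hX hX' := by
    have e1 : d% (fun y ↦ inner ℝ ((X + X') y) (Z y)) x
        = d% (fun y ↦ inner ℝ (X y) (Z y) + inner ℝ (X' y) (Z y)) x := by
      congr 1; ext y; simp [inner_add_left]
    have e2 : d% (fun y ↦ inner ℝ ((X + X') y) (Y y)) x
        = d% (fun y ↦ inner ℝ (X y) (Y y) + inner ℝ (X' y) (Y y)) x := by
      congr 1; ext y; simp [inner_add_left]
    simp only [koszul]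
    rw [e1, e2, mvfderiv_fun_add (mdiffAt_inner hX hZ) (mdiffAt_inner hX' hZ),
      mvfderiv_fun_add (mdiffAt_inner hX hY) (mdiffAt_inner hX' hY),
      mlieBracket_add_left hX hX', mlieBracket_add_left hX hX']
    simp [inner_add_left, inner_add_right]
    ring

theorem koszul_tensorial₂ (X Y : Π x : M, TangentSpace I x) (x : M)
    (hX : MDiffAt (T% X) x) (hY : MDiffAt (T% Y) x) :
    TensorialAt I E (fun Z ↦ koszul I X Y Z x) x where
  smul {f Z} hf hZ := by
    have e1 : d% (fun y ↦ inner ℝ (X y) ((f • Z) y)) x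
        = d% (fun y ↦ f y * inner ℝ (X y) (Z y)) x := by
      congr 1; ext y; simp [inner_smul_right]
    have e2 : d% (fun y ↦ inner ℝ (Y y) ((f • Z) y)) x
        = d% (fun y ↦ f y * inner ℝ (Y y) (Z y)) x := by
      congr 1; ext y; simp [inner_smul_right]
    simp only [koszul]
    rw [e1, e2, mvfderiv_fun_mul hf (mdiffAt_inner hX hZ), mvfderiv_fun_mul hf (mdiffAt_inner hY hZ),
      mlieBracket_smul_right hf hZ, mlieBracket_smul_right hf hZ]
    simp [inner_add_left, inner_smul_left, inner_smul_right, real_inner_comm]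
    ring
  add {Z Z'} hZ hZ' := by
    have e1 : d% (fun y ↦ inner ℝ (X y) ((Z + Z') y)) x
        = d% (fun y ↦ inner ℝ (X y) (Z y) + inner ℝ (X y) (Z' y)) x := by
      congr 1; ext y; simp [inner_add_right]
    have e2 : d% (fun y ↦ inner ℝ (Y y) ((Z + Z') y)) x
        = d% (fun y ↦ inner ℝ (Y y) (Z y) + inner ℝ (Y y) (Z' y)) x := by
      congr 1; ext y; simp [inner_add_right]
    simp only [koszul]
    rw [e1, e2, mvfderiv_fun_add (mdiffAt_inner hX hZ) (mdiffAt_inner hX hZ'),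
      mvfderiv_fun_add (mdiffAt_inner hY hZ) (mdiffAt_inner hY hZ'),
      mlieBracket_add_right hZ hZ', mlieBracket_add_right hZ hZ']
    simp [inner_add_left, inner_add_right]
    ring


theorem koszul_add {X Y Y' Z : Π x : M, TangentSpace I x} {x : M}
    (hX : MDiffAt (T% X) x) (hY : MDiffAt (T% Y) x) (hY' : MDiffAt (T% Y') x)
    (hZ : MDiffAt (T% Z) x) :
    koszul I X (Y + Y') Z x = koszul I X Y Z x + koszul I X Y' Z x := by
  have e1 : d% (fun y ↦ inner ℝ ((Y + Y') y) (Z y)) x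
      = d% (fun y ↦ inner ℝ (Y y) (Z y) + inner ℝ (Y' y) (Z y)) x := by
    congr 1; ext y; simp [inner_add_left]
  have e2 : d% (fun y ↦ inner ℝ (X y) ((Y + Y') y)) x
      = d% (fun y ↦ inner ℝ (X y) (Y y) + inner ℝ (X y) (Y' y)) x := by
    congr 1; ext y; simp [inner_add_right]
  simp only [koszul]
  rw [e1, e2, mvfderiv_fun_add (mdiffAt_inner hY hZ) (mdiffAt_inner hY' hZ),
    mvfderiv_fun_add (mdiffAt_inner hX hY) (mdiffAt_inner hX hY'),
    mlieBracket_add_right hY hY', mlieBracket_add_left hY hY']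
  simp [inner_add_left, inner_add_right]
  ring

theorem koszul_leibniz {f : M → ℝ} {X Y Z : Π x : M, TangentSpace I x} {x : M}
    (hf : MDiffAt f x) (hX : MDiffAt (T% X) x) (hY : MDiffAt (T% Y) x) (hZ : MDiffAt (T% Z) x) :
    koszul I X (f • Y) Z x = f x * koszul I X Y Z x + 2 * (d% f x (X x) * inner ℝ (Y x) (Z x)) := by
  have e1 : d% (fun y ↦ inner ℝ ((f • Y) y) (Z y)) x
      = d% (fun y ↦ f y * inner ℝ (Y y) (Z y)) x := by
    congr 1; ext y; simp [inner_smul_left]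
  have e2 : d% (fun y ↦ inner ℝ (X y) ((f • Y) y)) x
      = d% (fun y ↦ f y * inner ℝ (X y) (Y y)) x := by
    congr 1; ext y; simp [inner_smul_right]
  simp only [koszul]
  rw [e1, e2, mvfderiv_fun_mul hf (mdiffAt_inner hY hZ),
    mvfderiv_fun_mul hf (mdiffAt_inner hX hY),
    mlieBracket_smul_right hf hY, mlieBracket_smul_left hf hY]
  simp [inner_add_left, inner_smul_left, inner_smul_right, real_inner_comm]
  ring

open Classical in
/-- `∇_v Y` for the Levi-Civita connection, as a continuous linear map in the tangent vector `v`: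
`∇_{X x} Y` is the vector representing the functional `Z ↦ (1/2) koszul X Y Z x`.
The value is `0` where `Y` is not differentiable. -/
noncomputable def leviCivitaAux (Y : Π x : M, TangentSpace I x) (x : M) :
    TangentSpace I x →L[ℝ] TangentSpace I x :=
  haveI : FiniteDimensional ℝ (TangentSpace I x) := inferInstanceAs (FiniteDimensional ℝ E)
  haveI : CompleteSpace (TangentSpace I x) := FiniteDimensional.complete ℝ _
  if hY : MDiffAt (T% Y) x then
    LinearMap.toContinuousLinearMap <|
      (InnerProductSpace.toDual ℝ (TangentSpace I x)).symm.toLinearEquiv.toLinearMap ∘ₗ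
        ((1 / 2 : ℝ) • TensorialAt.mkHom₂ (fun X Z ↦ koszul I X Y Z x) x
          (fun Z hZ ↦ koszul_tensorial₁ Y Z x hY hZ)
          (fun X hX ↦ koszul_tensorial₂ X Y x hX hY)).toLinearMap
  else 0

theorem inner_leviCivitaAux {X Y Z : Π x : M, TangentSpace I x} {x : M}
    (hX : MDiffAt (T% X) x) (hY : MDiffAt (T% Y) x) (hZ : MDiffAt (T% Z) x) :
    inner ℝ (leviCivitaAux Y x (X x)) (Z x) = 1 / 2 * koszul I X Y Z x := by
  have : FiniteDimensional ℝ (TangentSpace I x) := inferInstanceAs (FiniteDimensional ℝ E)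
  have : CompleteSpace (TangentSpace I x) := FiniteDimensional.complete ℝ _
  rw [leviCivitaAux, dif_pos hY]
  have := TensorialAt.mkHom₂_apply (fun Z hZ ↦ koszul_tensorial₁ Y Z x hY hZ)
          (fun X hX ↦ koszul_tensorial₂ X Y x hX hY) hX hZ
  rw [← this]
  simp [inner_smul_left]

set_option linter.unusedSectionVars false in
theorem ext_inner_mdiffAt {x : M} {A B : TangentSpace I x →L[ℝ] TangentSpace I x}
    (h : ∀ X Z : Π x : M, TangentSpace I x, MDiffAt (T% X) x → MDiffAt (T% Z) x →
      inner ℝ (A (X x)) (Z x) = inner ℝ (B (X x)) (Z x)) : A = B := by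
  ext v
  refine ext_inner_right ℝ fun w ↦ ?_
  simpa using h (FiberBundle.extend E v) (FiberBundle.extend E w)
    (FiberBundle.mdifferentiableAt_extend ..) (FiberBundle.mdifferentiableAt_extend ..)

variable (I M) in
/-- The Levi-Civita connection of a Riemannian manifold. The vector `∇_X Y` at `x` is written
`leviCivita I M Y x (X x)`. -/
noncomputable def leviCivita : CovariantDerivative I E (TangentSpace I : M → Type _) where
  toFun := leviCivitaAux
  isCovariantDerivativeOnUniv :=
    { add := fun {Y Y' x} hY hY' _ ↦ ext_inner_mdiffAt fun X Z hX hZ ↦ by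
        rw [add_apply, inner_add_left,
          inner_leviCivitaAux hX (mdifferentiableAt_add_section hY hY') hZ,
          inner_leviCivitaAux hX hY hZ, inner_leviCivitaAux hX hY' hZ, koszul_add hX hY hY' hZ]
        ring
      leibniz := fun {Y f x} hY hf _ ↦ ext_inner_mdiffAt fun X Z hX hZ ↦ by
        rw [add_apply, inner_add_left,
          inner_leviCivitaAux hX (hf.smul_section hY) hZ, koszul_leibniz hf hX hY hZ]
        simp only [smul_apply, ContinuousLinearMap.smulRight_apply,
          inner_smul_left, inner_leviCivitaAux hX hY hZ]
        simp
        ring }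

/-- The Levi-Civita connection is torsion free. -/
theorem leviCivita_torsion : (leviCivita I M).torsion = 0 := by
  rw [CovariantDerivative.torsion_eq_zero_iff]
  intro X Y x hX hY
  refine ext_inner_right ℝ fun w ↦ ?_
  have hZ := FiberBundle.mdifferentiableAt_extend I E w
  have h1 := inner_leviCivitaAux hX hY hZ
  have h2 := inner_leviCivitaAux hY hX hZ
  have e : d% (fun y ↦ inner ℝ (X y) (Y y)) x = d% (fun y ↦ inner ℝ (Y y) (X y)) x := by
    congr 1; ext y; rw [real_inner_comm]
  have e' : mlieBracket I Y X x = - mlieBracket I X Y x := mlieBracket_swap_apply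
  simp only [koszul, e, e', FiberBundle.extend_apply_self, inner_neg_left] at h1 h2
  rw [inner_sub_left]
  change inner ℝ (leviCivitaAux Y x (X x)) w - inner ℝ (leviCivitaAux X x (Y x)) w = _
  rw [h1, h2]
  ring

/-- The Levi-Civita connection is compatible with the metric. -/
theorem leviCivita_metric {X Y Z : Π x : M, TangentSpace I x} {x : M}
    (hX : MDiffAt (T% X) x) (hY : MDiffAt (T% Y) x) (hZ : MDiffAt (T% Z) x) :
    d% (fun y ↦ inner ℝ (Y y) (Z y)) x (X x) =
      inner ℝ (leviCivita I M Y x (X x)) (Z x) + inner ℝ (Y x) (leviCivita I M Z x (X x)) := by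
  have h1 := inner_leviCivitaAux hX hY hZ
  have h2 := inner_leviCivitaAux hX hZ hY
  rw [real_inner_comm] at h2
  change _ = inner ℝ (leviCivitaAux Y x (X x)) (Z x) + inner ℝ (Y x) (leviCivitaAux Z x (X x))
  rw [h1, h2]
  have e : ∀ P Q : Π x : M, TangentSpace I x,
      d% (fun y ↦ inner ℝ (P y) (Q y)) x = d% (fun y ↦ inner ℝ (Q y) (P y)) x := by
    intro P Q; congr 1; ext y; rw [real_inner_comm]
  have e' : mlieBracket I Z Y x = - mlieBracket I Y Z x := mlieBracket_swap_apply
  simp only [koszul, e', inner_neg_left, e Z Y]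
  ring

end LeviCivita

section Forms
variable {E : Type*} [NormedAddCommGroup E] [NormedSpace ℝ E]
  {H : Type*} [TopologicalSpace H] (I : ModelWithCorners ℝ E H)
  {M : Type*} [TopologicalSpace M] [ChartedSpace H M]

/-- The exterior derivative of a 1-form, evaluated on vector fields:
`dη(X, Y) = X η(Y) - Y η(X) - η([X, Y])`. -/
noncomputable def extDerivOneForm (η : Π x : M, TangentSpace I x → ℝ)
    (X Y : Π x : M, TangentSpace I x) (x : M) : ℝ :=
  d% (fun y ↦ η y (Y y)) x (X x) - d% (fun y ↦ η y (X y)) x (Y x) - η x (mlieBracket I X Y x)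

/-- The exterior derivative of a 2-form, evaluated on vector fields:
`dΦ(X, Y, Z) = X Φ(Y, Z) + Y Φ(Z, X) + Z Φ(X, Y) - Φ([X, Y], Z) - Φ([Y, Z], X) - Φ([Z, X], Y)`. -/
noncomputable def extDerivTwoForm (Φ : Π x : M, TangentSpace I x → TangentSpace I x → ℝ)
    (X Y Z : Π x : M, TangentSpace I x) (x : M) : ℝ :=
  d% (fun y ↦ Φ y (Y y) (Z y)) x (X x) + d% (fun y ↦ Φ y (Z y) (X y)) x (Y x)
    + d% (fun y ↦ Φ y (X y) (Y y)) x (Z x)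
    - Φ x (mlieBracket I X Y x) (Z x) - Φ x (mlieBracket I Y Z x) (X x)
    - Φ x (mlieBracket I Z X x) (Y x)

variable {I}

/-- The wedge product of a 1-form and a 2-form at a point:
`(η ∧ Φ)(u, v, w) = η(u) Φ(v, w) + η(v) Φ(w, u) + η(w) Φ(u, v)`. -/
def wedgeOneTwo {x : M} (η : TangentSpace I x → ℝ) (Φ : TangentSpace I x → TangentSpace I x → ℝ)
    (u v w : TangentSpace I x) : ℝ :=
  η u * Φ v w + η v * Φ w u + η w * Φ u v

end Forms

section AlmostContact
variable {E : Type*} [NormedAddCommGroup E] [NormedSpace ℝ E]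
  {H : Type*} [TopologicalSpace H] (I : ModelWithCorners ℝ E H)
  (M : Type*) [TopologicalSpace M] [ChartedSpace H M] [IsManifold I ∞ M]
  [RiemannianBundle (fun x : M ↦ TangentSpace I x)]

/-- A (smooth) almost contact metric structure `(φ, ξ, η, g)` on a Riemannian manifold `(M, g)`. -/
structure AlmostContactMetricStructure where
  /-- the `(1,1)`-tensor field `φ` -/
  phi : Π x : M, TangentSpace I x →L[ℝ] TangentSpace I x
  /-- the vector field `ξ` -/
  xi : Π x : M, TangentSpace I x
  /-- the 1-form `η` -/
  eta : Π x : M, TangentSpace I x →L[ℝ] ℝ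
  contMDiff_phi : ContMDiff I (I.prod 𝓘(ℝ, E →L[ℝ] E)) ∞
    (fun x : M ↦ TotalSpace.mk' (E →L[ℝ] E)
      (E := fun x : M ↦ TangentSpace I x →L[ℝ] TangentSpace I x) x (phi x))
  contMDiff_xi : CMDiff ∞ (T% xi)
  contMDiff_eta : ContMDiff I (I.prod 𝓘(ℝ, E →L[ℝ] ℝ)) ∞
    (fun x : M ↦ TotalSpace.mk' (E →L[ℝ] ℝ)
      (E := fun x : M ↦ TangentSpace I x →L[ℝ] Bundle.Trivial M ℝ x) x (eta x))
  phi_phi : ∀ (x : M) (v : TangentSpace I x), phi x (phi x v) = -v + eta x v • xi x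
  eta_xi : ∀ x : M, eta x (xi x) = 1
  inner_phi_phi : ∀ (x : M) (v w : TangentSpace I x),
    inner ℝ (phi x v) (phi x w) = inner ℝ v w - eta x v * eta x w

variable {I M}

namespace AlmostContactMetricStructure

/-- The fundamental 2-form `Φ(X, Y) = g(X, φ Y)`. -/
noncomputable def fundamentalForm (S : AlmostContactMetricStructure I M) (x : M)
    (v w : TangentSpace I x) : ℝ :=
  inner ℝ v (S.phi x w)

/-- The distribution `𝓓 = ker η`. -/
noncomputable def distribution (S : AlmostContactMetricStructure I M) (x : M) :
    Submodule ℝ (TangentSpace I x) :=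
  LinearMap.ker (S.eta x).toLinearMap

/-- Almost Kenmotsu: `dη = 0` and `dΦ = 2 η ∧ Φ`, tested on all vector fields that are smooth at the
point under consideration. -/
structure IsAlmostKenmotsu (S : AlmostContactMetricStructure I M) : Prop where
  closed : ∀ (x : M) (X Y : Π x : M, TangentSpace I x),
    CMDiffAt ∞ (T% X) x → CMDiffAt ∞ (T% Y) x →
    extDerivOneForm I (fun y ↦ S.eta y) X Y x = 0
  extDeriv_fundamentalForm : ∀ (x : M) (X Y Z : Π x : M, TangentSpace I x),
    CMDiffAt ∞ (T% X) x → CMDiffAt ∞ (T% Y) x → CMDiffAt ∞ (T% Z) x →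
    extDerivTwoForm I S.fundamentalForm X Y Z x =
      2 * wedgeOneTwo (S.eta x) (S.fundamentalForm x) (X x) (Y x) (Z x)

/-- Holomorphically planar conformal vector (HPCV) fields: smooth vector fields `V` such that
`∇_X V = a X + b φ X` for all `X`, for some smooth functions `a` and `b`. -/
def IsHPCV [FiniteDimensional ℝ E]
    [IsContMDiffRiemannianBundle I ∞ E (fun x : M ↦ TangentSpace I x)]
    (S : AlmostContactMetricStructure I M) (V : Π x : M, TangentSpace I x) : Prop :=
  CMDiff ∞ (T% V) ∧ ∃ a b : M → ℝ, CMDiff ∞ a ∧ CMDiff ∞ b ∧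
    ∀ (x : M) (v : TangentSpace I x), leviCivita I M V x v = a x • v + b x • S.phi x v

end AlmostContactMetricStructure

end AlmostContact

section Submanifolds
variable {E : Type*} [NormedAddCommGroup E] [NormedSpace ℝ E]
  {H : Type*} [TopologicalSpace H] (I : ModelWithCorners ℝ E H)
  {M : Type*} [TopologicalSpace M] [ChartedSpace H M]
  {F : Type*} [NormedAddCommGroup F] [NormedSpace ℝ F]
  {G : Type*} [TopologicalSpace G] (J : ModelWithCorners ℝ F G)
  {N : Type*} [TopologicalSpace N] [ChartedSpace G N]

/-- The tangent space of an immersed submanifold `ι : N → M` at `p`, as a subspace of the tangent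
space of `M` at `ι p`. -/
noncomputable def immersedTangentSpace (ι : N → M) (p : N) : Submodule ℝ (TangentSpace I (ι p)) :=
  LinearMap.range (mfderiv J I ι p).toLinearMap

/-- `ι : N → M` is an integral manifold of the distribution `D`: an injectively immersed smooth
submanifold whose tangent space at every point is the value of `D` there. -/
structure IsIntegralManifold (D : Π x : M, Submodule ℝ (TangentSpace I x)) (ι : N → M) : Prop where
  isImmersion : Manifold.IsImmersion J I ∞ ι
  injective : Function.Injective ι
  tangentSpace_eq : ∀ p : N, immersedTangentSpace I J ι p = D (ι p)

variable [FiniteDimensional ℝ E] [IsManifold I ∞ M]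
  [RiemannianBundle (fun x : M ↦ TangentSpace I x)]
  [IsContMDiffRiemannianBundle I ∞ E (fun x : M ↦ TangentSpace I x)]

/-- The second fundamental form of the immersed submanifold `ι : N → M` at `p`, evaluated on vector
fields `X`, `Y` of `M` that are tangent to the submanifold along `ι` near `p`: the component of
`∇_X Y` normal to the submanifold. -/
noncomputable def secondFundamentalForm (ι : N → M) (X Y : Π x : M, TangentSpace I x) (p : N) :
    TangentSpace I (ι p) :=
  haveI : FiniteDimensional ℝ (TangentSpace I (ι p)) := inferInstanceAs (FiniteDimensional ℝ E)
  (immersedTangentSpace I J ι p)ᗮ.starProjection (leviCivita I M Y (ι p) (X (ι p)))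

/-- The immersed submanifold `ι : N → M` is totally umbilical: there is a smooth normal vector field
`H` along `ι` with `II(X, Y) = g(X, Y) H`. Tangent vectors of the submanifold are extended to vector
fields of `M` that are tangent to it along `ι` near the point under consideration. -/
def IsTotallyUmbilical (ι : N → M) : Prop :=
  ∃ H : Π p : N, TangentSpace I (ι p),
    ContMDiff J I.tangent ∞ (fun p ↦ (⟨ι p, H p⟩ : TangentBundle I M)) ∧
    (∀ p, H p ∈ (immersedTangentSpace I J ι p)ᗮ) ∧
    ∀ (p : N) (X Y : Π x : M, TangentSpace I x),
      CMDiffAt ∞ (T% X) (ι p) → CMDiffAt ∞ (T% Y) (ι p) →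
      (∀ᶠ q in 𝓝 p, X (ι q) ∈ immersedTangentSpace I J ι q) →
      (∀ᶠ q in 𝓝 p, Y (ι q) ∈ immersedTangentSpace I J ι q) →
      secondFundamentalForm I J ι X Y p = (inner ℝ (X (ι p)) (Y (ι p)) : ℝ) • H p

end Submanifolds

namespace AlmostContactMetricStructure

variable {E : Type*} [NormedAddCommGroup E] [NormedSpace ℝ E]
  {H : Type*} [TopologicalSpace H] {I : ModelWithCorners ℝ E H}
  {M : Type*} [TopologicalSpace M] [ChartedSpace H M] [IsManifold I ∞ M]
  [RiemannianBundle (fun x : M ↦ TangentSpace I x)]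

section Pointwise
variable (S : AlmostContactMetricStructure I M) (x : M)

theorem eta_phi (v : TangentSpace I x) : S.eta x (S.phi x v) = 0 := by
  have h1 := S.phi_phi x (S.phi x v)
  have hxi : S.phi x (S.phi x (S.xi x)) = 0 := by rw [S.phi_phi, S.eta_xi]; simp
  have hphixi : S.phi x (S.xi x) = S.eta x (S.phi x (S.xi x)) • S.xi x := by
    have h2 := S.phi_phi x (S.phi x (S.xi x))
    rw [hxi, map_zero] at h2
    exact (neg_add_eq_zero.mp h2.symm)
  have hc : S.eta x (S.phi x (S.xi x)) = 0 := by
    set c := S.eta x (S.phi x (S.xi x)) with hc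
    have h3 := hxi
    rw [hphixi, map_smul, hphixi, smul_smul] at h3
    have h4 := congrArg (S.eta x) h3
    rw [map_smul, S.eta_xi, map_zero] at h4
    simpa using h4
  have hphixi' : S.phi x (S.xi x) = 0 := by rw [hphixi, hc, zero_smul]
  rw [S.phi_phi x v, map_add, map_neg, map_smul, hphixi', smul_zero, add_zero] at h1
  have h5 : S.eta x (S.phi x v) • S.xi x = 0 := by simpa using h1
  have h6 := congrArg (S.eta x) h5
  rw [map_smul, S.eta_xi, map_zero] at h6
  simpa using h6

theorem phi_xi : S.phi x (S.xi x) = 0 := by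
  have h2 := S.phi_phi x (S.phi x (S.xi x))
  have hxi : S.phi x (S.phi x (S.xi x)) = 0 := by rw [S.phi_phi, S.eta_xi]; simp
  rw [hxi, map_zero, eta_phi, zero_smul, add_zero] at h2
  simpa using h2

theorem inner_xi (v : TangentSpace I x) : inner ℝ (S.xi x) v = S.eta x v := by
  have h := S.inner_phi_phi x (S.xi x) v
  rw [phi_xi, inner_zero_left, S.eta_xi, one_mul] at h
  linarith

theorem inner_phi_left (v w : TangentSpace I x) :
    inner ℝ (S.phi x v) w = - inner ℝ v (S.phi x w) := by
  have h := S.inner_phi_phi x (S.phi x v) w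
  rw [eta_phi, zero_mul, sub_zero, S.phi_phi, inner_add_left, inner_neg_left, inner_smul_left,
    inner_xi, eta_phi] at h
  simpa using h.symm

theorem inner_phi_self (v : TangentSpace I x) : inner ℝ (S.phi x v) v = 0 := by
  have h := S.inner_phi_left x v v
  rw [real_inner_comm v] at h
  rw [real_inner_comm]
  linarith

theorem eq_eta_smul_xi {v : TangentSpace I x} (hv : S.phi x v = 0) : v = S.eta x v • S.xi x := by
  have h := S.phi_phi x v
  rw [hv, map_zero] at h
  exact neg_add_eq_zero.mp h.symm

theorem norm_xi : ‖S.xi x‖ = 1 := by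
  have h := S.inner_xi x (S.xi x)
  rw [S.eta_xi, real_inner_self_eq_norm_sq] at h
  nlinarith [norm_nonneg (S.xi x)]

theorem abs_eta_le (v : TangentSpace I x) : |S.eta x v| ≤ ‖v‖ := by
  rw [← S.inner_xi]
  simpa [S.norm_xi] using abs_real_inner_le_norm (S.xi x) v

end Pointwise

variable (S : AlmostContactMetricStructure I M)

theorem mdiffAt_eta {X : Π x : M, TangentSpace I x} {x : M} (hX : MDiffAt (T% X) x) :
    MDiffAt (fun y ↦ S.eta y (X y)) x := by
  have h := MDifferentiableAt.clm_bundle_apply (E₁ := fun x : M ↦ TangentSpace I x)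
    (E₂ := Bundle.Trivial M ℝ) (b := fun y : M ↦ y) (ϕ := fun y ↦ S.eta y) (v := X)
    ((S.contMDiff_eta x).mdifferentiableAt (by simp)) hX
  exact (mdifferentiableAt_totalSpace ..).1 h |>.2

theorem contMDiffAt_phi {X : Π x : M, TangentSpace I x} {x : M} (hX : CMDiffAt ∞ (T% X) x) :
    CMDiffAt ∞ (T% (fun y ↦ S.phi y (X y))) x :=
  ContMDiffAt.clm_bundle_apply (E₁ := fun x : M ↦ TangentSpace I x)
    (E₂ := fun x : M ↦ TangentSpace I x) (b := fun y : M ↦ y) (ϕ := fun y ↦ S.phi y) (v := X)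
    (S.contMDiff_phi x) hX

theorem mdiffAt_xi (x : M) : MDiffAt (T% S.xi) x := (S.contMDiff_xi x).mdifferentiableAt (by simp)

variable [FiniteDimensional ℝ E] [IsContMDiffRiemannianBundle I ∞ E (fun x : M ↦ TangentSpace I x)]

theorem mlieBracket_eq {X Y : Π x : M, TangentSpace I x} {x : M}
    (hX : MDiffAt (T% X) x) (hY : MDiffAt (T% Y) x) :
    mlieBracket I X Y x = leviCivita I M Y x (X x) - leviCivita I M X x (Y x) :=
  ((CovariantDerivative.torsion_eq_zero_iff (leviCivita I M)).1 leviCivita_torsion hX hY).symm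

/-- The derivative of `η(Y)`, through `η = g(ξ, ·)`. -/
theorem mvfderiv_eta {X Y : Π x : M, TangentSpace I x} {x : M}
    (hX : MDiffAt (T% X) x) (hY : MDiffAt (T% Y) x) :
    d% (fun y ↦ S.eta y (Y y)) x (X x) =
      inner ℝ (leviCivita I M S.xi x (X x)) (Y x) + S.eta x (leviCivita I M Y x (X x)) := by
  rw [← S.inner_xi x, ← leviCivita_metric hX (S.mdiffAt_xi x) hY]
  simp only [S.inner_xi]

theorem eta_leviCivita_xi (x : M) (v : TangentSpace I x) :
    S.eta x (leviCivita I M S.xi x v) = 0 := by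
  have hX := FiberBundle.mdifferentiableAt_extend I E v
  have h := leviCivita_metric hX (S.mdiffAt_xi x) (S.mdiffAt_xi x)
  simp only [S.inner_xi, S.eta_xi, mvfderiv_const, FiberBundle.extend_apply_self] at h
  rw [real_inner_comm, S.inner_xi] at h
  simp at h
  linarith

/-- If `V = f ξ` satisfies `∇_v V = a v + b φ v`, then `df = a η` and
`f ∇_v ξ = a (v - η(v) ξ) + b φ v`. -/
theorem hpcv_identities {V : Π x : M, TangentSpace I x} {a b : M → ℝ} (hV : CMDiff ∞ (T% V))
    (hab : ∀ (x : M) (v : TangentSpace I x), leviCivita I M V x v = a x • v + b x • S.phi x v)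
    (hphiV : ∀ x : M, S.phi x (V x) = 0) (x : M) (v : TangentSpace I x) :
    d% (fun y ↦ S.eta y (V y)) x v = a x * S.eta x v ∧
    S.eta x (V x) • leviCivita I M S.xi x v
      = a x • (v - S.eta x v • S.xi x) + b x • S.phi x v := by
  have hf : MDiffAt (fun y ↦ S.eta y (V y)) x :=
    S.mdiffAt_eta ((hV x).mdifferentiableAt (by simp))
  have h := (leviCivita I M).isCovariantDerivativeOnUniv.leibniz (S.mdiffAt_xi x) hf (by trivial)
  have hVeq : (fun y ↦ S.eta y (V y)) • S.xi = V :=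
    funext fun y ↦ (S.eq_eta_smul_xi y (hphiV y)).symm
  rw [hVeq] at h
  have h' := congr($h v)
  change leviCivita I M V x v = _ at h'
  rw [hab] at h'
  change _ = S.eta x (V x) • leviCivita I M S.xi x v + d% (fun y ↦ S.eta y (V y)) x v • S.xi x at h'
  have h1 : d% (fun y ↦ S.eta y (V y)) x v = a x * S.eta x v := by
    have := congrArg (S.eta x) h'
    simp only [map_add, map_smul, eta_phi, eta_leviCivita_xi, S.eta_xi, smul_eq_mul] at this
    linarith
  refine ⟨h1, ?_⟩
  rw [h1] at h'
  rw [smul_sub, smul_smul]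
  rw [← sub_eq_iff_eq_add] at h'
  rw [← h']
  abel

/-- `dη = 0` makes `∇ξ` symmetric. -/
theorem IsAlmostKenmotsu.leviCivita_xi_symm {S : AlmostContactMetricStructure I M}
    (hS : S.IsAlmostKenmotsu) (x : M) (v w : TangentSpace I x) :
    inner ℝ (leviCivita I M S.xi x v) w = inner ℝ (leviCivita I M S.xi x w) v := by
  have h := hS.closed x (FiberBundle.extend E v) (FiberBundle.extend E w)
    (FiberBundle.contMDiffAt_extend I E v) (FiberBundle.contMDiffAt_extend I E w)
  have hX' := FiberBundle.mdifferentiableAt_extend I E v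
  have hY' := FiberBundle.mdifferentiableAt_extend I E w
  rw [extDerivOneForm, mvfderiv_eta S hX' hY', mvfderiv_eta S hY' hX', mlieBracket_eq hX' hY',
    map_sub] at h
  simp only [FiberBundle.extend_apply_self] at h
  linarith

/-- On `ker η`, the condition `dΦ = 2 η ∧ Φ` fixes the trace of `∇ξ` over the plane of `v, φ v`. -/
theorem IsAlmostKenmotsu.inner_leviCivita_xi {S : AlmostContactMetricStructure I M}
    (hS : S.IsAlmostKenmotsu) (x : M) {v : TangentSpace I x} (hv : S.eta x v = 0) :
    inner ℝ (leviCivita I M S.xi x v) v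
      + inner ℝ (leviCivita I M S.xi x (S.phi x v)) (S.phi x v) = 2 * inner ℝ v v := by
  set Z : Π y : M, TangentSpace I y := FiberBundle.extend E v with hZdef
  have hZx : Z x = v := FiberBundle.extend_apply_self ..
  have hZ : CMDiffAt ∞ (T% Z) x := FiberBundle.contMDiffAt_extend I E v
  set Y : Π y : M, TangentSpace I y := fun y ↦ S.phi y (Z y) with hYdef
  have hY : CMDiffAt ∞ (T% Y) x := S.contMDiffAt_phi hZ
  have hYx : Y x = S.phi x v := by rw [hYdef]; simp only [hZx]
  have hZ' : MDiffAt (T% Z) x := hZ.mdifferentiableAt (by simp)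
  have hY' : MDiffAt (T% Y) x := hY.mdifferentiableAt (by simp)
  have hxi := S.mdiffAt_xi x
  have h := hS.extDeriv_fundamentalForm x S.xi Y Z (S.contMDiff_xi x) hY hZ
  have hphiv : S.phi x (S.phi x v) = -v := by rw [S.phi_phi, hv, zero_smul, add_zero]
  have e1 : ∀ y, S.fundamentalForm y (Y y) (Z y) = inner ℝ (Y y) (Y y) := fun y ↦ rfl
  have e2 : ∀ y, S.fundamentalForm y (Z y) (S.xi y) = 0 := fun y ↦ by
    rw [fundamentalForm, phi_xi, inner_zero_right]
  have e3 : ∀ y, S.fundamentalForm y (S.xi y) (Y y) = 0 := fun y ↦ by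
    rw [fundamentalForm, inner_xi, eta_phi]
  have e4 : ∀ u, S.fundamentalForm x u (S.xi x) = 0 := fun u ↦ by
    rw [fundamentalForm, phi_xi, inner_zero_right]
  have e5 : ∀ u, S.fundamentalForm x u v = inner ℝ u (S.phi x v) := fun u ↦ rfl
  have e6 : ∀ u, S.fundamentalForm x u (S.phi x v) = - inner ℝ u v := fun u ↦ by
    rw [fundamentalForm, hphiv, inner_neg_right]
  have hYY : inner ℝ (S.phi x v) (S.phi x v) = inner ℝ v v := by
    rw [S.inner_phi_phi, hv]; ring
  have m1 := leviCivita_metric hxi hY' hY'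
  have m2 := leviCivita_metric hxi hZ' hZ'
  have hηZ : MDiffAt (fun y ↦ S.eta y (Z y)) x := S.mdiffAt_eta hZ'
  have m3 : d% (fun y ↦ inner ℝ (Y y) (Y y)) x (S.xi x)
      = d% (fun y ↦ inner ℝ (Z y) (Z y)) x (S.xi x) := by
    have e : (fun y ↦ inner ℝ (Y y) (Y y))
        = fun y ↦ inner ℝ (Z y) (Z y) - S.eta y (Z y) * S.eta y (Z y) :=
      funext fun y ↦ S.inner_phi_phi y _ _
    have hηη : MDiffAt (fun y ↦ S.eta y (Z y) * S.eta y (Z y)) x := hηZ.mul hηZ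
    rw [e, mvfderiv_fun_sub (mdiffAt_inner hZ' hZ') hηη, mvfderiv_fun_mul hηZ hηZ]
    simp [hZx, hv]
  have c0 : ∀ (c : ℝ), d% (fun _ : M ↦ c) x = 0 := fun c ↦ mvfderiv_const c
  simp only [extDerivTwoForm, wedgeOneTwo, e1, e2, e3, e4, c0, S.eta_xi, hZx, hv,
    mlieBracket_eq hxi hY', mlieBracket_eq hZ' hxi, hYx, S.eta_phi, zero_apply] at h
  rw [e5, e5, e6, inner_sub_left, inner_sub_left, hYY] at h
  rw [hYx, real_inner_comm _ (S.phi x v)] at m1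
  rw [hZx, real_inner_comm _ v] at m2
  linarith

end AlmostContactMetricStructure

section UniqueContinuation

variable {E : Type*} [NormedAddCommGroup E] [NormedSpace ℝ E]
  {H : Type*} [TopologicalSpace H] {I : ModelWithCorners ℝ E H} [I.Boundaryless]
  {M : Type*} [TopologicalSpace M] [ChartedSpace H M] [IsManifold I 1 M]
  [RiemannianBundle (fun x : M ↦ TangentSpace I x)]
  [IsContinuousRiemannianBundle E (fun x : M ↦ TangentSpace I x)]

attribute [local instance] normedAddCommGroupTangentSpaceVectorSpace
  normedSpaceTangentSpaceVectorSpace in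
theorem eventually_norm_mfderiv_symm_extChartAt_le (x : M) :
    ∃ C : ℝ, 0 ≤ C ∧ ∀ᶠ z in 𝓝 (extChartAt I x x), ∀ w : E,
      ‖mfderiv 𝓘(ℝ, E) I (extChartAt I x).symm z w‖ ≤ C * ‖w‖ := by
  obtain ⟨C, hC, h⟩ := eventually_norm_mfderivWithin_symm_extChartAt_lt I x
  refine ⟨C, hC.le, ?_⟩
  rw [I.range_eq_univ, nhdsWithin_univ] at h
  filter_upwards [h] with z hz w
  rw [mfderivWithin_univ] at hz
  exact ContinuousLinearMap.le_of_opNorm_le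
    (mfderiv 𝓘(ℝ, E) I (extChartAt I x).symm z) hz.le w

theorem eventually_eq_zero_of_abs_mvfderiv_le {f : M → ℝ} (hf : MDiff f)
    (hbound : ∀ (x : M) (v : TangentSpace I x), |d% f x v| ≤ |f x| * ‖v‖)
    {x : M} (hx : f x = 0) : ∀ᶠ y in 𝓝 x, f y = 0 := by
  obtain ⟨C, hC, h⟩ := eventually_norm_mfderiv_symm_extChartAt_le (I := I) x
  obtain ⟨r, hr, hball⟩ := Metric.eventually_nhds_iff_ball.1
    (h.and (extChartAt_target_mem_nhds (I := I) x))
  set F : E → ℝ := f ∘ (extChartAt I x).symm with hF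
  have hderiv : ∀ z ∈ Metric.ball (extChartAt I x x) r,
      DifferentiableAt ℝ F z ∧ ∀ w : E, |fderiv ℝ F z w| ≤ C * ‖w‖ * |F z| := by
    intro z hz
    obtain ⟨hz1, hz2⟩ := hball z hz
    have hsymm : MDifferentiableAt 𝓘(ℝ, E) I (extChartAt I x).symm z :=
      (contMDiffOn_extChartAt_symm (n := 1) x).contMDiffAt
        ((isOpen_extChartAt_target x).mem_nhds hz2) |>.mdifferentiableAt (by simp)
    have hcomp := mfderiv_comp z (hf _) hsymm
    refine ⟨((hf _).comp z hsymm).differentiableAt, fun w ↦ ?_⟩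
    have e : fderiv ℝ F z w =
        d% f ((extChartAt I x).symm z) (mfderiv 𝓘(ℝ, E) I (extChartAt I x).symm z w) := by
      rw [← mfderiv_eq_fderiv]
      exact congr($hcomp w)
    rw [e]
    calc _ ≤ |F z| * ‖mfderiv 𝓘(ℝ, E) I (extChartAt I x).symm z w‖ := hbound _ _
      _ ≤ |F z| * (C * ‖w‖) := by gcongr; exact hz1 w
      _ = _ := by ring
  have hmem : ∀ᶠ y in 𝓝 x, extChartAt I x y ∈ Metric.ball (extChartAt I x x) r :=
    (continuousAt_extChartAt x).preimage_mem_nhds (Metric.ball_mem_nhds _ hr)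
  filter_upwards [hmem, extChartAt_source_mem_nhds (I := I) x] with y hy hys
  set z₀ := extChartAt I x x
  set w := extChartAt I x y - z₀ with hw
  have hseg : ∀ t ∈ Set.Icc (0 : ℝ) 1, z₀ + t • w ∈ Metric.ball z₀ r := fun t ht ↦
    (convex_ball z₀ r).add_smul_sub_mem (Metric.mem_ball_self hr) hy ht
  have hg : ∀ t ∈ Set.Icc (0 : ℝ) 1,
      HasDerivAt (fun t : ℝ ↦ F (z₀ + t • w)) (fderiv ℝ F (z₀ + t • w) w) t := by
    intro t ht
    have h1 : HasDerivAt (fun t : ℝ ↦ z₀ + t • w) w t := by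
      simpa using ((hasDerivAt_id t).smul_const w).const_add z₀
    exact (hderiv _ (hseg t ht)).1.hasFDerivAt.comp_hasDerivAt t h1
  have key := eq_zero_of_abs_deriv_le_mul_abs_self_of_eq_zero_right
    (f := fun t : ℝ ↦ F (z₀ + t • w)) (f' := fun t ↦ fderiv ℝ F (z₀ + t • w) w)
    (K := C * ‖w‖) (a := 0) (b := 1)
    (fun t ht ↦ (hg t ht).continuousAt.continuousWithinAt)
    (fun t ht ↦ (hg t (Set.Ico_subset_Icc_self ht)).hasDerivWithinAt)
    (by simp [hF, z₀, hx])
    (fun t ht ↦ (hderiv _ (hseg t (Set.Ico_subset_Icc_self ht))).2 w) 1 (by simp)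
  have hend : z₀ + (1 : ℝ) • w = extChartAt I x y := by rw [one_smul, hw, add_sub_cancel]
  rw [hend, hF, Function.comp_apply, (extChartAt I x).left_inv hys] at key
  exact key

/-- A function whose differential is bounded by its own size vanishes on the whole connected
component of each of its zeros. -/
theorem eq_zero_on_connectedComponent_of_abs_mvfderiv_le {f : M → ℝ} (hf : MDiff f)
    (hbound : ∀ (x : M) (v : TangentSpace I x), |d% f x v| ≤ |f x| * ‖v‖)
    {x : M} (hx : f x = 0) : ∀ y ∈ connectedComponent x, f y = 0 := by
  have hopen : IsOpen {y | f y = 0} := isOpen_iff_mem_nhds.2 fun y hy ↦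
    eventually_eq_zero_of_abs_mvfderiv_le hf hbound hy
  have hclosed : IsClosed {y | f y = 0} := isClosed_eq hf.continuous continuous_const
  exact (IsClopen.connectedComponent_subset ⟨hclosed, hopen⟩ hx)

end UniqueContinuation

namespace AlmostContactMetricStructure

variable {E : Type*} [NormedAddCommGroup E] [NormedSpace ℝ E] [FiniteDimensional ℝ E]
  {H : Type*} [TopologicalSpace H] {I : ModelWithCorners ℝ E H}
  {M : Type*} [TopologicalSpace M] [ChartedSpace H M] [IsManifold I ∞ M]
  [RiemannianBundle (fun x : M ↦ TangentSpace I x)]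
  [IsContMDiffRiemannianBundle I ∞ E (fun x : M ↦ TangentSpace I x)]
  (S : AlmostContactMetricStructure I M)

variable {S} in
/-- The coefficients of an HPCV field `V = f ξ` are `a = f` and `b = 0`. -/
theorem IsAlmostKenmotsu.hpcv_coeff (hS : S.IsAlmostKenmotsu)
    {V : Π x : M, TangentSpace I x} {a b : M → ℝ} (hV : CMDiff ∞ (T% V))
    (hab : ∀ (x : M) (v : TangentSpace I x), leviCivita I M V x v = a x • v + b x • S.phi x v)
    (hphiV : ∀ x : M, S.phi x (V x) = 0) {x : M} {v : TangentSpace I x} (hv : S.eta x v = 0)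
    (hv0 : v ≠ 0) : a x = S.eta x (V x) ∧ b x = 0 := by
  have h1 := (S.hpcv_identities hV hab hphiV x v).2
  have h2 := (S.hpcv_identities hV hab hphiV x (S.phi x v)).2
  rw [hv, zero_smul, sub_zero] at h1
  rw [S.eta_phi, zero_smul, sub_zero, S.phi_phi, hv, zero_smul, add_zero] at h2
  set f := S.eta x (V x)
  have hvv : inner ℝ v v ≠ 0 := inner_self_ne_zero.2 hv0
  have hφφ : inner ℝ (S.phi x v) (S.phi x v) = inner ℝ v v := by
    rw [S.inner_phi_phi, hv]; ring
  have hφv := S.inner_phi_self x v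
  have hvφ : inner ℝ v (S.phi x v) = 0 := by rw [real_inner_comm]; exact hφv
  have i1 : f * inner ℝ (leviCivita I M S.xi x v) v = a x * inner ℝ v v := by
    have := congrArg (fun u ↦ inner ℝ u v) h1
    simpa only [inner_smul_left, inner_add_left, hφv, mul_zero, add_zero] using! this
  have i2 : f * inner ℝ (leviCivita I M S.xi x v) (S.phi x v) = b x * inner ℝ v v := by
    have := congrArg (fun u ↦ inner ℝ u (S.phi x v)) h1
    simpa only [inner_smul_left, inner_add_left, hvφ, hφφ, mul_zero, zero_add] using! this
  have i3 : f * inner ℝ (leviCivita I M S.xi x (S.phi x v)) (S.phi x v) = a x * inner ℝ v v := by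
    have := congrArg (fun u ↦ inner ℝ u (S.phi x v)) h2
    simpa only [inner_smul_left, inner_add_left, inner_neg_left, hvφ, hφφ, mul_zero, neg_zero,
      add_zero] using! this
  have i4 : f * inner ℝ (leviCivita I M S.xi x (S.phi x v)) v = - (b x * inner ℝ v v) := by
    have := congrArg (fun u ↦ inner ℝ u v) h2
    simpa only [inner_smul_left, inner_add_left, inner_neg_left, hφv, mul_zero, zero_add,
      mul_neg] using! this
  constructor
  · apply mul_right_cancel₀ hvv
    linear_combination (-1 / 2 : ℝ) * i1 - (1 / 2 : ℝ) * i3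
      + (f / 2) * hS.inner_leviCivita_xi x hv
  · apply mul_right_cancel₀ hvv
    rw [zero_mul]
    linear_combination (-1 / 2 : ℝ) * i2 + (1 / 2 : ℝ) * i4
      + (f / 2) * hS.leviCivita_xi_symm x v (S.phi x v)

variable {S} in
theorem IsAlmostKenmotsu.leviCivita_xi [I.Boundaryless] (hS : S.IsAlmostKenmotsu)
    {V : Π x : M, TangentSpace I x} (hV : S.IsHPCV V)
    (hV_ne : ∀ x : M, ∃ y ∈ connectedComponent x, V y ≠ 0)
    (hphiV : ∀ x : M, S.phi x (V x) = 0)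
    (hdim : ∀ x : M, ∃ v : TangentSpace I x, S.eta x v = 0 ∧ v ≠ 0)
    {x : M} {v : TangentSpace I x} (hv : S.eta x v = 0) : leviCivita I M S.xi x v = v := by
  obtain ⟨hVs, a, b, -, -, hab⟩ := hV
  have hcoeff : ∀ y, a y = S.eta y (V y) ∧ b y = 0 := fun y ↦ by
    obtain ⟨w, hw, hw0⟩ := hdim y
    exact hS.hpcv_coeff hVs hab hphiV hw hw0
  have hf : MDiff (fun y ↦ S.eta y (V y)) := fun y ↦
    S.mdiffAt_eta ((hVs y).mdifferentiableAt (by simp))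
  have hfx : S.eta x (V x) ≠ 0 := by
    intro h0
    obtain ⟨y, hy, hVy⟩ := hV_ne x
    have : IsContinuousRiemannianBundle E (fun x : M ↦ TangentSpace I x) := by
      obtain ⟨g, hg, hg'⟩ := IsContMDiffRiemannianBundle.exists_contMDiff (IB := I) (n := ∞)
        (F := E) (E := fun x : M ↦ TangentSpace I x)
      exact ⟨g, hg.continuous, hg'⟩
    have h := eq_zero_on_connectedComponent_of_abs_mvfderiv_le hf (fun z w ↦ by
      rw [(S.hpcv_identities hVs hab hphiV z w).1, (hcoeff z).1, abs_mul]
      gcongr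
      exact S.abs_eta_le z w) h0 y hy
    apply hVy
    rw [S.eq_eta_smul_xi y (hphiV y), h, zero_smul]
  have h := (S.hpcv_identities hVs hab hphiV x v).2
  rw [(hcoeff x).1, (hcoeff x).2, hv, zero_smul, zero_smul, add_zero, sub_zero] at h
  exact smul_right_injective _ hfx h

/-- If `∇_v ξ = v` on `ker η`, then the integral manifolds of `ker η` are totally umbilical with mean
curvature vector `-ξ`. -/
theorem isTotallyUmbilical_of_leviCivita_xi
    {F : Type*} [NormedAddCommGroup F] [NormedSpace ℝ F]
    {G : Type*} [TopologicalSpace G] {J : ModelWithCorners ℝ F G}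
    {N : Type*} [TopologicalSpace N] [ChartedSpace G N] [IsManifold J ∞ N] {ι : N → M}
    (hι : IsIntegralManifold I J S.distribution ι)
    (hxi : ∀ (p : N) (v : TangentSpace I (ι p)), S.eta (ι p) v = 0 →
      leviCivita I M S.xi (ι p) v = v) :
    IsTotallyUmbilical I J ι := by
  have hιs : ContMDiff J I ∞ ι := hι.isImmersion.contMDiff
  have htan : ∀ (p : N) (v : TangentSpace I (ι p)),
      v ∈ immersedTangentSpace I J ι p ↔ S.eta (ι p) v = 0 := by
    intro p v
    rw [hι.tangentSpace_eq p]
    exact Iff.rfl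
  have hperp : ∀ (p : N) (c : ℝ), c • S.xi (ι p) ∈ (immersedTangentSpace I J ι p)ᗮ := by
    intro p c
    apply Submodule.smul_mem
    rw [Submodule.mem_orthogonal']
    intro u hu
    rw [S.inner_xi]
    exact (htan p u).1 hu
  refine ⟨fun p ↦ (-1 : ℝ) • S.xi (ι p), ?_, fun p ↦ hperp p _, ?_⟩
  · have h : CMDiff ∞ (T% ((-1 : ℝ) • S.xi)) := ContMDiff.const_smul_section S.contMDiff_xi
    exact h.comp hιs
  intro p X Y hX hY hXt hYt
  have hX' : MDiffAt (T% X) (ι p) := hX.mdifferentiableAt (by simp)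
  have hY' : MDiffAt (T% Y) (ι p) := hY.mdifferentiableAt (by simp)
  have hXp : S.eta (ι p) (X (ι p)) = 0 := (htan p _).1 hXt.self_of_nhds
  obtain ⟨u, hu⟩ : ∃ u, mfderiv J I ι p u = X (ι p) := hXt.self_of_nhds
  have hηY : d% (fun y ↦ S.eta y (Y y)) (ι p) (X (ι p)) = 0 := by
    have h1 := mvfderiv_comp_apply p (S.mdiffAt_eta hY') ((hιs p).mdifferentiableAt (by simp)) u
    have h2 : (fun y ↦ S.eta y (Y y)) ∘ ι =ᶠ[𝓝 p] fun _ ↦ (0 : ℝ) := by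
      filter_upwards [hYt] with q hq using (htan q _).1 hq
    rw [← hu, ← h1, mvfderiv, h2.mfderiv_eq, mfderiv_const]
    rfl
  have hη : S.eta (ι p) (leviCivita I M Y (ι p) (X (ι p))) = - inner ℝ (X (ι p)) (Y (ι p)) := by
    have h := S.mvfderiv_eta hX' hY'
    rw [hηY, hxi p _ hXp] at h
    linarith
  have : FiniteDimensional ℝ (TangentSpace I (ι p)) := inferInstanceAs (FiniteDimensional ℝ E)
  rw [secondFundamentalForm, smul_smul]
  refine Submodule.eq_starProjection_of_mem_orthogonal (hperp p _)
    (Submodule.le_orthogonal_orthogonal _ ?_)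
  rw [htan, map_sub, map_smul, S.eta_xi, hη]
  simp

end AlmostContactMetricStructure

theorem LinearMap.exists_apply_eq_zero_ne_zero {W : Type*} [AddCommGroup W] [Module ℝ W]
    [FiniteDimensional ℝ W] (l : W →ₗ[ℝ] ℝ) (h : 1 < Module.finrank ℝ W) :
    ∃ v, l v = 0 ∧ v ≠ 0 := by
  obtain ⟨v, hv, hv0⟩ := Submodule.exists_mem_ne_zero_of_ne_bot
    (LinearMap.ker_ne_bot_of_finrank_lt (f := l) (by simpa using h))
  exact ⟨v, hv, hv0⟩

theorem corollary3p1 (n : ℕ)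
    {M : Type*} [TopologicalSpace M] [T2Space M] [SecondCountableTopology M]
    [ChartedSpace (EuclideanSpace ℝ (Fin (2 * n + 1))) M] [IsManifold (𝓡 (2 * n + 1)) ∞ M]
    [RiemannianBundle (fun x : M ↦ TangentSpace (𝓡 (2 * n + 1)) x)]
    [IsContMDiffRiemannianBundle (𝓡 (2 * n + 1)) ∞ (EuclideanSpace ℝ (Fin (2 * n + 1)))
      (fun x : M ↦ TangentSpace (𝓡 (2 * n + 1)) x)]
    (S : AlmostContactMetricStructure (𝓡 (2 * n + 1)) M) (hS : S.IsAlmostKenmotsu)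
    (V : Π x : M, TangentSpace (𝓡 (2 * n + 1)) x) (hV : S.IsHPCV V)
    (hV_ne : ∀ x : M, ∃ y ∈ connectedComponent x, V y ≠ 0)
    (hphiV : ∀ x : M, S.phi x (V x) = 0)
    {N : Type*} [TopologicalSpace N] [ChartedSpace (EuclideanSpace ℝ (Fin (2 * n))) N]
    [IsManifold (𝓡 (2 * n)) ∞ N]
    (ι : N → M) (hι : IsIntegralManifold (𝓡 (2 * n + 1)) (𝓡 (2 * n)) S.distribution ι) :
    IsTotallyUmbilical (𝓡 (2 * n + 1)) (𝓡 (2 * n)) ι := by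
  refine S.isTotallyUmbilical_of_leviCivita_xi hι fun p v hv ↦ ?_
  rcases Nat.eq_zero_or_pos n with rfl | hn
  · have hmem : v ∈ immersedTangentSpace (𝓡 (2 * 0 + 1)) (𝓡 (2 * 0)) ι p := by
      rw [hι.tangentSpace_eq p]
      exact hv
    obtain ⟨u, rfl⟩ := hmem
    have : Subsingleton (EuclideanSpace ℝ (Fin (2 * 0))) := by
      rw [← Module.finrank_eq_zero_iff_of_free (R := ℝ), finrank_euclideanSpace_fin]
    have hu : u = 0 := Subsingleton.elim (α := EuclideanSpace ℝ (Fin (2 * 0))) _ _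
    rw [hu, map_zero, map_zero]
  · refine hS.leviCivita_xi hV hV_ne hphiV (fun x ↦ ?_) hv
    have : FiniteDimensional ℝ (TangentSpace (𝓡 (2 * n + 1)) x) :=
      inferInstanceAs (FiniteDimensional ℝ (EuclideanSpace ℝ (Fin (2 * n + 1))))
    refine LinearMap.exists_apply_eq_zero_ne_zero (S.eta x).toLinearMap ?_
    change 1 < Module.finrank ℝ (EuclideanSpace ℝ (Fin (2 * n + 1)))
    rw [finrank_euclideanSpace_fin]
    omega
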